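/- Let $E\subseteq X\times X$ be an equivalence relation on a standard Borel space $X$ such that $E$ is a Borel subset of $X\times X$ and every $E$-class is countably infinite (that is, $E$ is an aperiodic countable Borel equivalence relation). Suppose that $E$ is nonsmooth: there are no standard Borel space $Y$ and Borel map $f\colon X\to Y$ such that $x\mathrel{E}y\iff f(x)=f(y)$ for all $x,y\in X$. Let $\mathbf{G}=(X,E\setminus\Delta_X)$ be the graph on $X$ in which two distinct points are adjacent if and only if they are $E$-equivalent. Then $$D(\mathbf{G})=\aleph_0<2^{\aleph_0}=D_B(\mathbf{G})=D_{SB}(\mathbf{G}).$$ Here $D(\mathbf{G})$ is the least cardinality of a set $I$ for which there is a map $c\colon X\to I$ such that every automorphism $\varphi\neq\mathrm{id}$ of $\mathbf{G}$ satisfies $c(\varphi(x))\neq c(x)$ for some $x\in X$; $D_B(\mathbf{G})$ is the least cardinality of a standard Borel space $I$ for which there is a Borel map $c\colon X\to I$ with the same property; and $D_{SB}(\mathbf{G})$ is the least cardinality of a standard Borel space $I$ for which there is a Borel map $c\colon X\to I$ having this property for all Borel automorphisms $\varphi\neq\mathrm{id}$ of $\mathbf{G}$. -/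

import Mathlib

universe u

namespace BorelDistinguishing

/-- The equivalence relation `E` is a Borel subset of `X × X`. -/
def IsBorelRel {X : Type u} [MeasurableSpace X] (E : Setoid X) : Prop :=
  MeasurableSet {p : X × X | E p.1 p.2}

/-- Every equivalence class is countable. -/
def HasCountableClasses {X : Type u} (E : Setoid X) : Prop :=
  ∀ x : X, {y : X | E x y}.Countable

/-- Every equivalence class is infinite. -/
def IsAperiodic {X : Type u} (E : Setoid X) : Prop :=
  ∀ x : X, {y : X | E x y}.Infinite

/-- `E` is smooth: it is the kernel of a Borel map to a standard Borel space `Y`. As every standard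
Borel space has a copy in every universe, `Y` may be taken in the universe of `X`. -/
def IsSmooth {X : Type u} [MeasurableSpace X] (E : Setoid X) : Prop :=
  ∃ (Y : Type u) (_ : MeasurableSpace Y) (_ : StandardBorelSpace Y) (f : X → Y),
    Measurable f ∧ ∀ x y : X, E x y ↔ f x = f y

/-- The graph on `X` whose edge relation is `E` minus the diagonal. -/
def graphOf {X : Type u} (E : Setoid X) : SimpleGraph X where
  Adj x y := E x y ∧ x ≠ y
  symm := ⟨fun _ _ h => ⟨E.symm' h.1, h.2.symm⟩⟩
  loopless := ⟨fun _ h => h.2 rfl⟩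

/-- `φ` is a Borel automorphism of `G`. -/
def IsBorelAut {X : Type u} [MeasurableSpace X] {G : SimpleGraph X} (φ : G ≃g G) : Prop :=
  Measurable φ ∧ Measurable φ.symm

/-- No nontrivial automorphism of `G` preserves the coloring `c`. -/
def IsDistinguishing {X I : Type u} (G : SimpleGraph X) (c : X → I) : Prop :=
  ∀ φ : G ≃g G, φ ≠ RelIso.refl G.Adj → ∃ x : X, c x ≠ c (φ x)

/-- `c` is Borel and no nontrivial automorphism of `G` preserves it. -/
def IsBorelDistinguishing {X I : Type u} [MeasurableSpace X] [MeasurableSpace I]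
    (G : SimpleGraph X) (c : X → I) : Prop :=
  Measurable c ∧ ∀ φ : G ≃g G, φ ≠ RelIso.refl G.Adj → ∃ x : X, c x ≠ c (φ x)

/-- `c` is Borel and no nontrivial Borel automorphism of `G` preserves it. -/
def IsStrictlyBorelDistinguishing {X I : Type u} [MeasurableSpace X] [MeasurableSpace I]
    (G : SimpleGraph X) (c : X → I) : Prop :=
  Measurable c ∧
    ∀ φ : G ≃g G, IsBorelAut φ → φ ≠ RelIso.refl G.Adj → ∃ x : X, c x ≠ c (φ x)

/-- The distinguishing number `D(G)`. (The infimum of a nonempty class of cardinals is attained;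
the class is nonempty because the identity of `X` is distinguishing.) -/
noncomputable def distNumber {X : Type u} (G : SimpleGraph X) : Cardinal.{u} :=
  sInf {κ | ∃ (I : Type u) (c : X → I), IsDistinguishing G c ∧ Cardinal.mk I = κ}

/-- The Borel distinguishing number `D_B(G)`; the color spaces are standard Borel. -/
noncomputable def borelDistNumber {X : Type u} [MeasurableSpace X] (G : SimpleGraph X) :
    Cardinal.{u} :=
  sInf {κ | ∃ (I : Type u) (_ : MeasurableSpace I) (_ : StandardBorelSpace I) (c : X → I),
    IsBorelDistinguishing G c ∧ Cardinal.mk I = κ}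

/-- The strictly Borel distinguishing number `D_SB(G)`; the color spaces are standard Borel. -/
noncomputable def strictBorelDistNumber {X : Type u} [MeasurableSpace X] (G : SimpleGraph X) :
    Cardinal.{u} :=
  sInf {κ | ∃ (I : Type u) (_ : MeasurableSpace I) (_ : StandardBorelSpace I) (c : X → I),
    IsStrictlyBorelDistinguishing G c ∧ Cardinal.mk I = κ}

end BorelDistinguishing

namespace BorelDistinguishing

variable {X : Type u} {E : Setoid X}

/-! Transposing two equivalent points is a Borel automorphism, so every coloring in question is
injective on classes; as classes are infinite, at least `ℵ₀` colors are needed. If two classes had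
the same color set, exchanging their equally colored points would be a Borel automorphism, its
support being countable. So, for a strictly Borel distinguishing coloring, color sets separate
classes. With countably many colors this would make `E` smooth, by Lusin–Souslin. Hence the color
space is uncountable standard Borel, of size continuum, and the identity coloring attains this.
Without Borelness, choice enumerates each class, and the coloring spreads a binary code of the class
along the enumeration (`exists_isDistinguishing_nat_bool`). -/

/-- A permutation that preserves and reflects `E` is an automorphism of `graphOf E`. -/
def autOfPerm (σ : Equiv.Perm X) (hσ : ∀ x y, E (σ x) (σ y) ↔ E x y) : graphOf E ≃g graphOf E where
  toEquiv := σ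
  map_rel_iff' {x y} := and_congr (hσ x y) σ.injective.ne_iff

@[simp] theorem autOfPerm_apply (σ : Equiv.Perm X) (hσ : ∀ x y, E (σ x) (σ y) ↔ E x y) (x : X) :
    autOfPerm σ hσ x = σ x := rfl

theorem rel_map_iff (φ : graphOf E ≃g graphOf E) (x y : X) : E (φ x) (φ y) ↔ E x y := by
  by_cases h : x = y
  · subst h
    exact iff_of_true (E.refl' _) (E.refl' _)
  · have hφ : E (φ x) (φ y) ∧ φ x ≠ φ y ↔ E x y ∧ x ≠ y := φ.map_rel_iff
    exact ⟨fun hE => (hφ.1 ⟨hE, fun he => h (φ.injective he)⟩).1, fun hE => (hφ.2 ⟨hE, h⟩).1⟩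

/-- A permutation with countable support preserving `E` yields a Borel automorphism. -/
theorem isBorelAut_autOfPerm [MeasurableSpace X] [MeasurableSingletonClass X] (σ : Equiv.Perm X)
    (hσ : ∀ x y, E (σ x) (σ y) ↔ E x y) (hc : {x | σ x ≠ x}.Countable) :
    IsBorelAut (autOfPerm σ hσ) := by
  refine ⟨measurable_id.measurable_of_countable_ne (hc.mono fun x hx => Ne.symm hx),
    measurable_id.measurable_of_countable_ne (hc.mono fun x hx => ?_)⟩
  intro h
  apply hx
  change x = σ.symm x
  rw [Equiv.eq_symm_apply]
  exact h

/-- A coloring preserved by no nontrivial finitely supported Borel automorphism separates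
equivalent points. -/
theorem IsStrictlyBorelDistinguishing.injOn_classes [MeasurableSpace X]
    [MeasurableSingletonClass X] {I : Type u} [MeasurableSpace I] {c : X → I}
    (hc : IsStrictlyBorelDistinguishing (graphOf E) c) {x y : X} (hxy : E x y)
    (h : c x = c y) : x = y := by
  classical
  by_contra hne
  have hE : ∀ z, E z (Equiv.swap x y z) := by
    intro z
    rw [Equiv.swap_apply_def]
    split_ifs with h1 h2
    · exact h1 ▸ hxy
    · exact h2 ▸ E.symm' hxy
    · exact E.refl' z
  have hσ : ∀ a b, E (Equiv.swap x y a) (Equiv.swap x y b) ↔ E a b := fun a b =>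
    ⟨fun hab => E.trans' (E.trans' (hE a) hab) (E.symm' (hE b)),
      fun hab => E.trans' (E.trans' (E.symm' (hE a)) hab) (hE b)⟩
  obtain ⟨z, hz⟩ := hc.2 (autOfPerm _ hσ)
    (isBorelAut_autOfPerm _ hσ (((Set.finite_singleton y).insert x).countable.mono fun z hz => by
      by_contra hz'
      simp only [Set.mem_insert_iff, Set.mem_singleton_iff, not_or] at hz'
      exact hz (Equiv.swap_apply_of_ne_of_ne hz'.1 hz'.2)))
    (fun he => hne (by simpa using (DFunLike.congr_fun he x).symm))
  apply hz
  rw [autOfPerm_apply, Equiv.swap_apply_def]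
  split_ifs with h1 h2
  · rw [h1, h]
  · rw [h2, h]
  · rfl

theorem IsDistinguishing.injOn_classes {I : Type u} {c : X → I}
    (hc : IsDistinguishing (graphOf E) c) {x y : X} (hxy : E x y) (h : c x = c y) : x = y := by
  -- For the discrete σ-algebras every coloring is measurable, so the Borel version applies.
  let _ : MeasurableSpace X := ⊤
  let _ : MeasurableSpace I := ⊤
  exact IsStrictlyBorelDistinguishing.injOn_classes
    ⟨measurable_from_top, fun φ _ hφ => hc φ hφ⟩ hxy h

/-! ### Exchanging two classes -/

/-- The partner relation of the map exchanging equally colored points of the classes of `x`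
and `y`. -/
def Partner (E : Setoid X) {I : Type u} (c : X → I) (x y z w : X) : Prop :=
  (E x z ∧ E y w ∨ E y z ∧ E x w) ∧ c z = c w

theorem Partner.symm {I : Type u} {c : X → I} {x y z w : X} (h : Partner E c x y z w) :
    Partner E c x y w z :=
  ⟨h.1.elim (fun h => Or.inr h.symm) (fun h => Or.inl h.symm), h.2.symm⟩

/-- The two classes are disjoint, so `z` determines which of them contains its partner, and colors
are injective there. -/
theorem Partner.unique {I : Type u} {c : X → I} (hc : ∀ a b, E a b → c a = c b → a = b)
    {x y z w w' : X} (hxy : ¬ E x y) (h : Partner E c x y z w) (h' : Partner E c x y z w') :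
    w = w' := by
  refine hc _ _ ?_ (h.2.symm.trans h'.2)
  obtain ⟨⟨h1, h2⟩ | ⟨h1, h2⟩, -⟩ := h <;> obtain ⟨⟨h3, h4⟩ | ⟨h3, h4⟩, -⟩ := h'
  · exact E.trans' (E.symm' h2) h4
  · exact absurd (E.trans' h1 (E.symm' h3)) hxy
  · exact absurd (E.trans' h3 (E.symm' h1)) hxy
  · exact E.trans' (E.symm' h2) h4

/-- If a coloring is injective on each class and two distinct countable classes have the same set
of colors, then exchanging these classes is a nontrivial Borel automorphism preserving colors. -/
theorem exists_borelAut_of_image_eq [MeasurableSpace X] [MeasurableSingletonClass X]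
    (hE : HasCountableClasses E) {I : Type u} {c : X → I}
    (hc : ∀ a b, E a b → c a = c b → a = b) {x y : X} (hxy : ¬ E x y)
    (himg : c '' {z | E x z} = c '' {z | E y z}) :
    ∃ φ : graphOf E ≃g graphOf E, IsBorelAut φ ∧ φ ≠ RelIso.refl (graphOf E).Adj ∧
      ∀ z, c z = c (φ z) := by
  classical
  let f : X → X := fun z => if h : ∃ w, Partner E c x y z w then h.choose else z
  have hf : ∀ {z w}, Partner E c x y z w → f z = w := by
    intro z w h
    have h' : ∃ w, Partner E c x y z w := ⟨w, h⟩
    have : f z = h'.choose := dif_pos h'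
    rw [this]
    exact h'.choose_spec.unique hc hxy h
  have hf' : ∀ {z}, (¬ ∃ w, Partner E c x y z w) → f z = z := fun h => dif_neg h
  have hx : ∀ z, E x z → ∃ w, Partner E c x y z w := by
    intro z hz
    obtain ⟨w, hw, hcw⟩ : c z ∈ c '' {z | E y z} := himg ▸ ⟨z, hz, rfl⟩
    exact ⟨w, Or.inl ⟨hz, hw⟩, hcw.symm⟩
  have hy : ∀ z, E y z → ∃ w, Partner E c x y z w := by
    intro z hz
    obtain ⟨w, hw, hcw⟩ : c z ∈ c '' {z | E x z} := himg ▸ ⟨z, hz, rfl⟩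
    exact ⟨w, Or.inr ⟨hz, hw⟩, hcw.symm⟩
  have hinv : Function.Involutive f := by
    intro z
    by_cases h : ∃ w, Partner E c x y z w
    · obtain ⟨w, hw⟩ := h
      rw [hf hw, hf hw.symm]
    · rw [hf' h, hf' h]
  have hfx : ∀ z, E x z → E y (f z) := by
    intro z hz
    obtain ⟨w, hw⟩ := hx z hz
    rw [hf hw]
    exact hw.1.elim (·.2) fun h => absurd (E.trans' hz (E.symm' h.1)) hxy
  have hfy : ∀ z, E y z → E x (f z) := by
    intro z hz
    obtain ⟨w, hw⟩ := hy z hz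
    rw [hf hw]
    exact hw.1.elim (fun h => absurd (E.trans' h.1 (E.symm' hz)) hxy) (·.2)
  have hfn : ∀ z, ¬ E x z → ¬ E y z → f z = z := fun z h1 h2 =>
    hf' fun ⟨_, hw⟩ => hw.1.elim (fun h => h1 h.1) fun h => h2 h.1
  have hpres : ∀ a b, E a b → E (f a) (f b) := by
    intro a b hab
    by_cases h1 : E x a
    · exact E.trans' (E.symm' (hfx a h1)) (hfx b (E.trans' h1 hab))
    by_cases h2 : E y a
    · exact E.trans' (E.symm' (hfy a h2)) (hfy b (E.trans' h2 hab))
    rw [hfn a h1 h2, hfn b (fun h => h1 (E.trans' h (E.symm' hab)))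
      (fun h => h2 (E.trans' h (E.symm' hab)))]
    exact hab
  have hσ : ∀ a b, E (hinv.toPerm f a) (hinv.toPerm f b) ↔ E a b := by
    refine fun a b => ⟨fun h => ?_, hpres a b⟩
    have := hpres _ _ h
    rwa [Function.Involutive.coe_toPerm, hinv, hinv] at this
  refine ⟨autOfPerm _ hσ, isBorelAut_autOfPerm _ hσ (((hE x).union (hE y)).mono fun z hz => ?_),
    fun h => ?_, fun z => ?_⟩
  · by_contra hz'
    simp only [Set.mem_union, Set.mem_ofPred_eq, not_or] at hz'
    exact hz (hfn z hz'.1 hz'.2)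
  · have h1 : f x = x := DFunLike.congr_fun h x
    exact hxy (E.symm' (h1 ▸ hfx x (E.refl' x)))
  · change c z = c (f z)
    by_cases h : ∃ w, Partner E c x y z w
    · obtain ⟨w, hw⟩ := h
      rw [hf hw, hw.2]
    · rw [hf' h]

/-! ### Color sets and smoothness -/

/-- The colors seen in a class depend on the class in a Borel way, if the coloring is Borel and
injective on each class. -/
theorem measurableSet_exists_color [MeasurableSpace X] [StandardBorelSpace X] (hE : IsBorelRel E)
    {I : Type u} [MeasurableSpace I] [MeasurableSingletonClass I] {c : X → I} (hm : Measurable c)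
    (hc : ∀ a b, E a b → c a = c b → a = b) (i : I) :
    MeasurableSet {x | ∃ y, E x y ∧ c y = i} := by
  have hs : MeasurableSet ({p : X × X | E p.1 p.2} ∩ {p | c p.2 = i}) :=
    hE.inter ((hm.comp measurable_snd) (measurableSet_singleton i))
  -- Lusin–Souslin: the projection is injective here, since a class has at most one point of color
  -- `i`.
  have := hs.image_of_measurable_injOn measurable_fst (by
    rintro ⟨a, b⟩ ⟨h1, h2⟩ ⟨a', b'⟩ ⟨h3, h4⟩ (rfl : a = a')
    exact Prod.ext rfl (hc b b' (E.trans' (E.symm' h1) h3) (h2.trans h4.symm)))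
  convert this using 1
  ext x
  simp

/-- A strictly Borel distinguishing coloring of a nonsmooth countable Borel equivalence relation
uses uncountably many colors. -/
theorem not_countable_of_isStrictlyBorelDistinguishing [MeasurableSpace X] [StandardBorelSpace X]
    (hB : IsBorelRel E) (hE : HasCountableClasses E) (hns : ¬ IsSmooth E)
    {I : Type u} [MeasurableSpace I] [StandardBorelSpace I] {c : X → I}
    (hc : IsStrictlyBorelDistinguishing (graphOf E) c) : ¬ Countable I := by
  intro hI
  have hinj : ∀ a b, E a b → c a = c b → a = b := fun a b => hc.injOn_classes
  -- Countability of `I` makes the product `I → Prop` standard Borel.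
  refine hns ⟨I → Prop, inferInstance, inferInstance, fun x i => ∃ y, E x y ∧ c y = i,
    measurable_pi_lambda _ fun i =>
      measurableSet_setOfPred.1 (measurableSet_exists_color hB hc.1 hinj i), fun x y => ⟨fun h => ?_,
    fun h => ?_⟩⟩
  · funext i
    exact propext ⟨fun ⟨z, hz, hi⟩ => ⟨z, E.trans' (E.symm' h) hz, hi⟩,
      fun ⟨z, hz, hi⟩ => ⟨z, E.trans' h hz, hi⟩⟩
  · by_contra hxy
    obtain ⟨φ, hφ, hne, hpres⟩ := exists_borelAut_of_image_eq hE hinj hxy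
      (Set.ext fun i => iff_of_eq (congrFun h i))
    obtain ⟨z, hz⟩ := hc.2 φ hφ hne
    exact hz (hpres z)

/-! ### Cardinalities and the countable coloring -/

theorem exists_injective_nat_bool (X : Type u) [MeasurableSpace X] [StandardBorelSpace X] :
    ∃ f : X → ℕ → Bool, Function.Injective f :=
  (MeasurableSpace.measurable_injection_nat_bool_of_countablySeparated X).imp fun _ h => h.2

theorem mk_le_continuum (X : Type u) [MeasurableSpace X] [StandardBorelSpace X] :
    Cardinal.mk X ≤ 2 ^ Cardinal.aleph0.{u} := by
  obtain ⟨f, hf⟩ := exists_injective_nat_bool X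
  have := Cardinal.lift_mk_le_lift_mk_of_injective hf
  simpa using this

theorem continuum_le_mk (I : Type u) [MeasurableSpace I] [StandardBorelSpace I]
    (hI : ¬ Countable I) : 2 ^ Cardinal.aleph0.{u} ≤ Cardinal.mk I := by
  have e := (PolishSpace.measurableEquivNatBoolOfNotCountable hI).toEquiv
  have := Cardinal.mk_congr (e.trans Equiv.ulift.{u}.symm)
  simp [this]

/-- If there are at most continuum many points and every class is countably infinite, then
countably many colors distinguish. -/
theorem exists_isDistinguishing_nat_bool (hE : HasCountableClasses E) (hA : IsAperiodic E)
    {f : X → ℕ → Bool} (hf : Function.Injective f) :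
    ∃ c : X → ULift.{u} (ℕ × Bool), IsDistinguishing (graphOf E) c := by
  have hden : ∀ x : X, Nonempty ({y // E x y} ≃ ℕ) := fun x => by
    have : Countable {y // E x y} := hE x
    have : Infinite {y // E x y} := (hA x).to_subtype
    exact nonempty_equiv_of_countable
  let e : ∀ x : X, {y // E x y} ≃ ℕ := fun x => (hden x).some
  let r : X → X := fun x => (Quotient.mk E x).out
  have hr : ∀ x, E (r x) x := fun x => Quotient.mk_out x
  have hr' : ∀ x y, E x y → r x = r y := fun x y h => congrArg Quotient.out (Quotient.sound h)
  let idx : X → ℕ := fun x => e (r x) ⟨x, hr x⟩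
  -- A free `s` lets the enumeration of another point's representative be used without transport.
  have hidx : ∀ x s (hs : E s x), r x = s → idx x = e s ⟨x, hs⟩ := by
    rintro x _ hs rfl
    rfl
  -- The `n`-th point of a class gets `n` and the `n`-th bit of the code of its representative.
  refine ⟨fun x => ⟨(idx x, f (r x) (idx x))⟩, fun φ hφ => ?_⟩
  by_contra! hcon
  apply hφ
  ext x
  change φ x = x
  have h1 : ∀ z, idx z = idx (φ z) := fun z => congrArg (fun p => p.down.1) (hcon z)
  have h2 : ∀ z, f (r z) (idx z) = f (r (φ z)) (idx (φ z)) :=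
    fun z => congrArg (fun p => p.down.2) (hcon z)
  -- Since `φ` preserves indices and maps classes to classes, all bits of the two codes agree; so
  -- `φ` fixes each class.
  have hrr : r (φ x) = r x := by
    refine hf (funext fun n => ?_)
    let z := (e (r x)).symm n
    have hz : E x z := E.trans' (E.symm' (hr x)) z.2
    have hzn : idx z = n := by
      rw [hidx z (r x) z.2 (hr' x z hz).symm]
      exact (e (r x)).apply_symm_apply n
    have := h2 z
    rw [← h1, hzn, ← hr' x z hz, ← hr' (φ x) (φ z) ((rel_map_iff φ x z).2 hz)] at this
    exact this.symm
  have hx := h1 x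
  rw [hidx (φ x) (r x) (hrr ▸ hr (φ x)) hrr] at hx
  exact (congrArg Subtype.val ((e (r x)).injective hx)).symm

theorem isBorelDistinguishing_id [MeasurableSpace X] (G : SimpleGraph X) :
    IsBorelDistinguishing G (id : X → X) := by
  refine ⟨measurable_id, fun φ hφ => ?_⟩
  by_contra! h
  exact hφ (RelIso.ext fun x => (h x).symm)

theorem IsBorelDistinguishing.isStrictlyBorelDistinguishing [MeasurableSpace X] {I : Type u}
    [MeasurableSpace I] {G : SimpleGraph X} {c : X → I} (h : IsBorelDistinguishing G c) :
    IsStrictlyBorelDistinguishing G c :=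
  ⟨h.1, fun φ _ hφ => h.2 φ hφ⟩

/-- Excludes empty `X`, where `distNumber` would be 0. -/
theorem IsSmooth.of_isEmpty [MeasurableSpace X] [StandardBorelSpace X] [IsEmpty X] :
    IsSmooth E :=
  ⟨X, inferInstance, inferInstance, id, measurable_id, isEmptyElim⟩

theorem distNumber_graphOf [Nonempty X] (hE : HasCountableClasses E) (hA : IsAperiodic E)
    {f : X → ℕ → Bool} (hf : Function.Injective f) :
    distNumber (graphOf E) = Cardinal.aleph0.{u} := by
  obtain ⟨c, hc⟩ := exists_isDistinguishing_nat_bool hE hA hf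
  refine le_antisymm (csInf_le' ⟨_, c, hc, by simp⟩) (le_csInf ⟨_, _, c, hc, rfl⟩ ?_)
  rintro _ ⟨I, d, hd, rfl⟩
  obtain ⟨x⟩ := ‹Nonempty X›
  have : Infinite {y // E x y} := (hA x).to_subtype
  rw [Cardinal.aleph0_le_mk_iff]
  exact Infinite.of_injective (fun y : {y // E x y} => d y) fun a b h =>
    Subtype.ext (hd.injOn_classes (E.trans' (E.symm' a.2) b.2) h)

end BorelDistinguishing

theorem mainTheorem2 {X : Type u} [MeasurableSpace X] [StandardBorelSpace X] (E : Setoid X)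
    (hBorel : BorelDistinguishing.IsBorelRel E)
    (hCountable : BorelDistinguishing.HasCountableClasses E)
    (hAperiodic : BorelDistinguishing.IsAperiodic E)
    (hNonsmooth : ¬ BorelDistinguishing.IsSmooth E) :
    BorelDistinguishing.distNumber (BorelDistinguishing.graphOf E) = Cardinal.aleph0.{u} ∧
    Cardinal.aleph0.{u} < (2 : Cardinal.{u}) ^ Cardinal.aleph0.{u} ∧
    BorelDistinguishing.borelDistNumber (BorelDistinguishing.graphOf E)
      = (2 : Cardinal.{u}) ^ Cardinal.aleph0.{u} ∧
    BorelDistinguishing.strictBorelDistNumber (BorelDistinguishing.graphOf E)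
      = (2 : Cardinal.{u}) ^ Cardinal.aleph0.{u} := by
  have hne : Nonempty X := by
    by_contra h
    have := not_nonempty_iff.1 h
    exact hNonsmooth BorelDistinguishing.IsSmooth.of_isEmpty
  obtain ⟨f, hf⟩ := BorelDistinguishing.exists_injective_nat_bool X
  have hid := BorelDistinguishing.isBorelDistinguishing_id (BorelDistinguishing.graphOf E)
  refine ⟨BorelDistinguishing.distNumber_graphOf hCountable hAperiodic hf, Cardinal.cantor _,
    le_antisymm ?_ ?_, le_antisymm ?_ ?_⟩
  · refine (csInf_le' (a := Cardinal.mk X) ?_).trans (BorelDistinguishing.mk_le_continuum X)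
    exact ⟨X, _, ‹_›, id, hid, rfl⟩
  · refine le_csInf ⟨_, X, _, ‹_›, id, hid, rfl⟩ ?_
    rintro _ ⟨I, _, _, c, hc, rfl⟩
    exact BorelDistinguishing.continuum_le_mk I
      (BorelDistinguishing.not_countable_of_isStrictlyBorelDistinguishing hBorel hCountable
        hNonsmooth hc.isStrictlyBorelDistinguishing)
  · refine (csInf_le' (a := Cardinal.mk X) ?_).trans (BorelDistinguishing.mk_le_continuum X)
    exact ⟨X, _, ‹_›, id, hid.isStrictlyBorelDistinguishing, rfl⟩
  · refine le_csInf ⟨_, X, _, ‹_›, id, hid.isStrictlyBorelDistinguishing, rfl⟩ ?_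
    rintro _ ⟨I, _, _, c, hc, rfl⟩
    exact BorelDistinguishing.continuum_le_mk I
      (BorelDistinguishing.not_countable_of_isStrictlyBorelDistinguishing hBorel hCountable
        hNonsmooth hc)
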